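/- Let $d\ge 1$ and $1\le q<\infty$, and write $|x|_\infty=\max_k|x_k|$. A positive sequence $w=(w(i))_{i\in\mathbb Z^d}$ is a discrete $A_q$-weight if there is a constant $C>0$ such that for all $a\in\mathbb Z^d$ and all integers $N\ge 1$, with sums and infimum over the integer points of the cube, $$\Big(N^{-d}\sum_{i\in a+[0,N-1]^d}w(i)\Big)\Big(N^{-d}\sum_{i\in a+[0,N-1]^d}w(i)^{-1/(q-1)}\Big)^{q-1}\le C\quad\text{if } q>1,$$ $$N^{-d}\sum_{i\in a+[0,N-1]^d}w(i)\le C\inf_{i\in a+[0,N-1]^d}w(i)\quad\text{if } q=1.$$ For complex sequences $c$ on $\mathbb Z^d$ let $\|c\|_{q,w}=\big(\sum_{i\in\mathbb Z^d}|c(i)|^q\,w(i)\big)^{1/q}$ and let $\ell^q_w$ be the space of all $c$ with $\|c\|_{q,w}<\infty$. An infinite complex matrix $A=(a(i,j))_{i,j\in\mathbb Z^d}$ has $\ell^q_w$-stability if there is a constant $C>0$ such that for every $c\in\ell^q_w$ the sequence $Ac=\big(\sum_{j}a(i,j)c(j)\big)_{i}$ is well defined (the series converge absolutely) and $C^{-1}\|c\|_{q,w}\le\|Ac\|_{q,w}\le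 C\|c\|_{q,w}$. Let $\mathcal B$ be the class of all infinite complex matrices $A=(a(i,j))_{i,j\in\mathbb Z^d}$ with $$\sum_{k\in\mathbb Z^d}\ \sup_{|i-j|_\infty\ge|k|_\infty}|a(i,j)|<\infty .$$ Let $w$ be a discrete $A_q$-weight and let $A=(a(i-j))_{i,j\in\mathbb Z^d}$ be a Toeplitz matrix in $\mathcal B$. Then $A$ has $\ell^q_w$-stability if and only if $$\hat a(\xi):=\sum_{n\in\mathbb Z^d}a(n)\,e^{-\sqrt{-1}\,n\cdot\xi}\ne 0\quad\text{for all }\xi\in\mathbb R^d .$$ -/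

import Mathlib

open scoped ENNReal

noncomputable section

/-- The `Beurling` norm `∑_{k ∈ ℤ^d} sup_{|i-j|_∞ ≥ |k|_∞} |a(i,j)|`, with values in `[0,∞]`, of an
infinite matrix indexed by `ℤ^d × ℤ^d`. The norm on `Fin d → ℤ` is the sup norm `|·|_∞`. -/
def beurlingNorm {d : ℕ} (A : Matrix (Fin d → ℤ) (Fin d → ℤ) ℂ) : ℝ≥0∞ :=
  ∑' k : Fin d → ℤ, ⨆ (i : Fin d → ℤ) (j : Fin d → ℤ) (_ : ‖k‖ ≤ ‖i - j‖), ‖A i j‖ₑ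

/-- Membership in the class `𝓑` of infinite matrices with finite Beurling norm. -/
def MemBeurling {d : ℕ} (A : Matrix (Fin d → ℤ) (Fin d → ℤ) ℂ) : Prop :=
  beurlingNorm A < ∞

/-- The Toeplitz matrix `(a(i-j))` of a sequence `a` on `ℤ^d`. -/
def toeplitz {d : ℕ} (a : (Fin d → ℤ) → ℂ) : Matrix (Fin d → ℤ) (Fin d → ℤ) ℂ :=
  Matrix.of fun i j => a (i - j)

/-- The symbol `â(ξ) = ∑_n a(n) exp(-√-1 n·ξ)`. The series converges absolutely whenever
`toeplitz a` belongs to `𝓑`. -/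
def symbol {d : ℕ} (a : (Fin d → ℤ) → ℂ) (ξ : Fin d → ℝ) : ℂ :=
  ∑' n : Fin d → ℤ, a n * Complex.exp (-Complex.I * ((∑ k, (n k : ℝ) * ξ k : ℝ) : ℂ))

/-- The integer points of the cube `a + [0, N-1]^d`. -/
def cube {d : ℕ} (a : Fin d → ℤ) (N : ℕ) : Finset (Fin d → ℤ) :=
  Finset.Icc a (fun k => a k + (N : ℤ) - 1)

/-- The average `N^{-d} ∑_{i ∈ a + [0,N-1]^d} f(i)`. -/
def cubeAvg {d : ℕ} (f : (Fin d → ℤ) → ℝ) (a : Fin d → ℤ) (N : ℕ) : ℝ :=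
  ((N : ℝ) ^ d)⁻¹ * ∑ i ∈ cube a N, f i

/-- Discrete Muckenhoupt `A_q`-weights on `ℤ^d`, for `1 ≤ q < ∞`. -/
def IsDiscreteAqWeight {d : ℕ} (q : ℝ) (w : (Fin d → ℤ) → ℝ) : Prop :=
  (∀ i, 0 < w i) ∧
  (1 < q → ∃ C : ℝ, 0 < C ∧ ∀ (a : Fin d → ℤ) (N : ℕ), 1 ≤ N →
    cubeAvg w a N * (cubeAvg (fun i => w i ^ (-(1 / (q - 1)))) a N) ^ (q - 1) ≤ C) ∧
  (q = 1 → ∃ C : ℝ, 0 < C ∧ ∀ (a : Fin d → ℤ) (N : ℕ), 1 ≤ N →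
    ∀ j ∈ cube a N, cubeAvg w a N ≤ C * w j)

/-- The weighted norm `(∑_i |c(i)|^q w(i))^{1/q}`, with values in `[0,∞]`. -/
def weightedNorm {d : ℕ} (q : ℝ) (w : (Fin d → ℤ) → ℝ) (c : (Fin d → ℤ) → ℂ) : ℝ≥0∞ :=
  (∑' i, ENNReal.ofReal (‖c i‖ ^ q * w i)) ^ (1 / q)

/-- Membership in `ℓ^q_w(ℤ^d)`. -/
def MemEllqw {d : ℕ} (q : ℝ) (w : (Fin d → ℤ) → ℝ) (c : (Fin d → ℤ) → ℂ) : Prop :=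
  weightedNorm q w c < ∞

/-- The sequence `Ac = (∑_j a(i,j) c(j))_i`. -/
def matrixApply {d : ℕ} (A : Matrix (Fin d → ℤ) (Fin d → ℤ) ℂ) (c : (Fin d → ℤ) → ℂ) :
    (Fin d → ℤ) → ℂ :=
  fun i => ∑' j, A i j * c j

/-- `A` has `ℓ^q_w`-stability: for all `c` in `ℓ^q_w` the sequence `Ac` is well defined (its
series converge absolutely) and `C⁻¹ ‖c‖_{q,w} ≤ ‖Ac‖_{q,w} ≤ C ‖c‖_{q,w}`. -/
def HasStability {d : ℕ} (q : ℝ) (w : (Fin d → ℤ) → ℝ)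
    (A : Matrix (Fin d → ℤ) (Fin d → ℤ) ℂ) : Prop :=
  ∃ C : ℝ, 0 < C ∧ ∀ c : (Fin d → ℤ) → ℂ, MemEllqw q w c →
    (∀ i, Summable fun j => A i j * c j) ∧
    ENNReal.ofReal C⁻¹ * weightedNorm q w c ≤ weightedNorm q w (matrixApply A c) ∧
    weightedNorm q w (matrixApply A c) ≤ ENNReal.ofReal C * weightedNorm q w c

end

open Filter Topology

noncomputable section

/-! Multiplication by `w^{1/q}` identifies `ℓ^q_w` with `ℓ^q`, so the question becomes one about
bounded operators on a Banach space. The weight enters through one estimate, `exists_layer_bound`: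
averages over centered cubes are bounded on `ℓ^q_w` uniformly in the side. A radially decreasing
summable kernel is a superposition of such averages, so the Beurling norm controls the operator norm
(`exists_kernel_bound`). Hence the shifts `U^n` have polynomially growing norms, and `A` is the norm
limit of `∑ a(n) U^n` over growing cubes (`exists_shifts`).

If the symbol has no zero, Gelfand theory in the double commutant of the shifts applies: a character
restricted to the shifts is a homomorphism of polynomial growth, hence `n ↦ exp(-√-1 n·ξ)`, so it
sends `A` to `â(ξ) ≠ 0`. Thus `A` is invertible among the bounded operators
(`isUnit_of_symbol_ne_zero`); the inverse need not be placed in `𝓑`.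

If `â(ξ) = 0`, a character cut off to a large cube is nearly annihilated by `A`
(`exists_approx_eigenvector`). The boundary layer is negligible for suitable cubes because the
weight of cubes grows only polynomially. -/

variable {d : ℕ}

/-! ### Sup norm and centered cubes -/

/-- The sup norm `|n|_∞` as a natural number. -/
def supAbs (n : Fin d → ℤ) : ℕ := Finset.univ.sup fun k => (n k).natAbs

lemma supAbs_le_iff {n : Fin d → ℤ} {m : ℕ} : supAbs n ≤ m ↔ ∀ k, |n k| ≤ m := by
  simp only [supAbs, Finset.sup_le_iff, Finset.mem_univ, true_imp_iff]
  exact forall_congr' fun k => by rw [Int.abs_eq_natAbs]; omega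

lemma abs_le_supAbs (n : Fin d → ℤ) (k : Fin d) : |n k| ≤ supAbs n :=
  supAbs_le_iff.1 le_rfl k

lemma norm_eq_supAbs (n : Fin d → ℤ) : ‖n‖ = supAbs n := by
  apply le_antisymm
  · rw [pi_norm_le_iff_of_nonneg (Nat.cast_nonneg _)]
    intro k
    rw [Int.norm_eq_abs]
    exact_mod_cast abs_le_supAbs n k
  · have h : supAbs n ≤ ⌊‖n‖⌋₊ := by
      rw [supAbs_le_iff]
      intro k
      have h1 := norm_le_pi_norm n k
      rw [Int.norm_eq_abs] at h1
      have h2 : (n k).natAbs ≤ ⌊‖n‖⌋₊ := by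
        apply Nat.le_floor
        rw [Nat.cast_natAbs]
        exact_mod_cast h1
      rw [Int.abs_eq_natAbs]
      omega
    exact (Nat.le_floor_iff (norm_nonneg _)).1 h

lemma supAbs_neg (n : Fin d → ℤ) : supAbs (-n) = supAbs n := by
  simp [supAbs]

lemma supAbs_sub_comm (i j : Fin d → ℤ) : supAbs (i - j) = supAbs (j - i) := by
  rw [← supAbs_neg, neg_sub]

lemma supAbs_add_le (i j : Fin d → ℤ) : supAbs (i + j) ≤ supAbs i + supAbs j := by
  rw [supAbs_le_iff]
  intro k
  have h1 := abs_le_supAbs i k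
  have h2 := abs_le_supAbs j k
  have h3 := abs_add_le (i k) (j k)
  simp only [Pi.add_apply, Nat.cast_add]
  omega

/-- The integer points of the cube with center `j` and side `2m+1`. -/
def centeredCube (m : ℕ) (j : Fin d → ℤ) : Finset (Fin d → ℤ) :=
  cube (fun k => j k - m) (2 * m + 1)

lemma mem_centeredCube {m : ℕ} {i j : Fin d → ℤ} :
    i ∈ centeredCube m j ↔ supAbs (i - j) ≤ m := by
  rw [supAbs_le_iff, centeredCube, cube, Finset.mem_Icc, Pi.le_def, Pi.le_def, ← forall_and]
  refine forall_congr' fun k => ?_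
  rw [abs_le, Pi.sub_apply]
  push_cast
  constructor <;> rintro ⟨h1, h2⟩ <;> constructor <;> linarith

lemma mem_centeredCube_comm {m : ℕ} {i j : Fin d → ℤ} :
    i ∈ centeredCube m j ↔ j ∈ centeredCube m i := by
  rw [mem_centeredCube, mem_centeredCube, supAbs_sub_comm]

lemma mem_centeredCube_zero {m : ℕ} {i : Fin d → ℤ} :
    i ∈ centeredCube m 0 ↔ supAbs i ≤ m := by
  rw [mem_centeredCube, sub_zero]

lemma card_centeredCube (m : ℕ) (j : Fin d → ℤ) :
    (centeredCube m j).card = (2 * m + 1) ^ d := by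
  rw [centeredCube, cube, Pi.card_Icc]
  have h : ∀ k : Fin d, (Finset.Icc (j k - (m : ℤ))
      (j k - (m : ℤ) + ((2 * m + 1 : ℕ) : ℤ) - 1)).card = 2 * m + 1 := by
    intro k
    rw [Int.card_Icc]
    push_cast
    omega
  rw [Finset.prod_congr rfl fun k _ => h k]
  simp

lemma centeredCube_subset {m : ℕ} {i j : Fin d → ℤ} (h : i ∈ centeredCube m j) :
    centeredCube m i ⊆ centeredCube (2 * m) j := by
  intro l hl
  rw [mem_centeredCube] at *
  have := supAbs_add_le (l - i) (i - j)
  rw [sub_add_sub_cancel] at this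
  omega

lemma centeredCube_mono {m n : ℕ} (h : m ≤ n) (j : Fin d → ℤ) :
    centeredCube m j ⊆ centeredCube n j := fun _ hl =>
  mem_centeredCube.2 ((mem_centeredCube.1 hl).trans h)

lemma sum_centeredCube_eq_tsum (m : ℕ) (i : Fin d → ℤ) (f : (Fin d → ℤ) → ℝ≥0∞) :
    ∑ j ∈ centeredCube m i, f j = ∑' j, if supAbs (i - j) ≤ m then f j else 0 := by
  rw [tsum_eq_sum (s := centeredCube m i)]
  · refine Finset.sum_congr rfl fun j hj => ?_
    rw [if_pos (mem_centeredCube.1 (mem_centeredCube_comm.1 hj))]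
  · intro j hj
    rw [mem_centeredCube_comm, mem_centeredCube] at hj
    rw [if_neg hj]

lemma tsum_sum_centeredCube_comm (m : ℕ) (F : (Fin d → ℤ) → (Fin d → ℤ) → ℝ≥0∞) :
    ∑' i, ∑ j ∈ centeredCube m i, F i j = ∑' j, ∑ i ∈ centeredCube m j, F i j := by
  simp_rw [sum_centeredCube_eq_tsum]
  rw [ENNReal.tsum_comm]
  simp_rw [supAbs_sub_comm]

/-- The number `(2m+1)^d` of points of a centered cube, in `[0,∞]`. -/
def cubeCard (d m : ℕ) : ℝ≥0∞ := (((2 * m + 1) ^ d : ℕ) : ℝ≥0∞)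

lemma cubeCard_ne_zero (m : ℕ) : cubeCard d m ≠ 0 := by
  simp [cubeCard]

lemma cubeCard_ne_top (m : ℕ) : cubeCard d m ≠ ∞ := ENNReal.natCast_ne_top _

lemma cubeCard_two_mul_le (m : ℕ) : cubeCard d (2 * m) ≤ 2 ^ d * cubeCard d m := by
  have : (2 * (2 * m) + 1) ^ d ≤ 2 ^ d * (2 * m + 1) ^ d := by
    rw [← mul_pow]
    exact Nat.pow_le_pow_left (by omega) d
  unfold cubeCard
  exact_mod_cast this

/-! ### The `A_q` condition and cube averages -/

/-- The `A_q` condition on centered cubes, for `q > 1`, as an inequality between sums. -/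
lemma IsDiscreteAqWeight.exists_sum_mul_le {q : ℝ} {w : (Fin d → ℤ) → ℝ}
    (hw : IsDiscreteAqWeight q w) (hq : 1 < q) :
    ∃ C : ℝ≥0∞, C ≠ ∞ ∧ ∀ (m : ℕ) (j : Fin d → ℤ),
      (∑ i ∈ centeredCube m j, ENNReal.ofReal (w i)) *
        (∑ i ∈ centeredCube m j, ENNReal.ofReal (w i ^ (-(1 / (q - 1))))) ^ (q - 1) ≤
        C * cubeCard d m ^ q := by
  obtain ⟨C, hC, h⟩ := hw.2.1 hq
  refine ⟨ENNReal.ofReal C, ENNReal.ofReal_ne_top, fun m j => ?_⟩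
  have h1 := h (fun k => j k - m) (2 * m + 1) (by omega)
  have hp : ∀ i, 0 < w i ^ (-(1 / (q - 1))) := fun i => Real.rpow_pos_of_pos (hw.1 i) _
  have hV : (0 : ℝ) < ((2 * m + 1 : ℕ) : ℝ) ^ d := by positivity
  set V : ℝ := ((2 * m + 1 : ℕ) : ℝ) ^ d with hVdef
  have hVe : cubeCard d m = ENNReal.ofReal V := by
    rw [hVdef, ← Nat.cast_pow, ENNReal.ofReal_natCast, cubeCard]
  have hs1 : 0 ≤ ∑ i ∈ centeredCube m j, w i := Finset.sum_nonneg fun i _ => (hw.1 i).le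
  have hs2 : 0 ≤ ∑ i ∈ centeredCube m j, w i ^ (-(1 / (q - 1))) :=
    Finset.sum_nonneg fun i _ => (hp i).le
  rw [hVe, ← ENNReal.ofReal_sum_of_nonneg fun i _ => (hw.1 i).le,
    ← ENNReal.ofReal_sum_of_nonneg fun i _ => (hp i).le,
    ENNReal.ofReal_rpow_of_nonneg hs2 (by linarith), ← ENNReal.ofReal_mul hs1,
    ENNReal.ofReal_rpow_of_nonneg hV.le (by linarith), ← ENNReal.ofReal_mul hC.le]
  apply ENNReal.ofReal_le_ofReal
  simp only [cubeAvg] at h1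
  change V⁻¹ * (∑ i ∈ centeredCube m j, w i) *
    (V⁻¹ * ∑ i ∈ centeredCube m j, w i ^ (-(1 / (q - 1)))) ^ (q - 1) ≤ C at h1
  rw [Real.mul_rpow (inv_nonneg.2 hV.le) hs2, Real.inv_rpow hV.le] at h1
  have h2 : V ^ q = V * V ^ (q - 1) := by
    rw [mul_comm, Real.rpow_sub_one hV.ne', div_mul_cancel₀ _ hV.ne']
  have h3 : 0 < V ^ (q - 1) := Real.rpow_pos_of_pos hV _
  rw [h2]
  calc _ = (V⁻¹ * (∑ i ∈ centeredCube m j, w i) * ((V ^ (q - 1))⁻¹ *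
        (∑ i ∈ centeredCube m j, w i ^ (-(1 / (q - 1)))) ^ (q - 1))) * (V * V ^ (q - 1)) := by
        field_simp
    _ ≤ C * (V * V ^ (q - 1)) := by gcongr

/-- Weighted power mean inequality for sums in `[0,∞]`. -/
lemma rpow_sum_mul_le {ι : Type*} (s : Finset ι) {q : ℝ} (hq : 1 ≤ q) (u f : ι → ℝ≥0∞) :
    (∑ i ∈ s, u i * f i) ^ q ≤ (∑ i ∈ s, u i) ^ (q - 1) * ∑ i ∈ s, u i * f i ^ q := by
  have hq0 : 0 < q := by linarith
  calc (∑ i ∈ s, u i * f i) ^ q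
      ≤ ((∑ i ∈ s, u i) ^ (1 - q⁻¹) * (∑ i ∈ s, u i * f i ^ q) ^ q⁻¹) ^ q :=
        ENNReal.rpow_le_rpow (ENNReal.inner_le_weight_mul_Lp_of_nonneg s hq u f) hq0.le
    _ = _ := by
        rw [ENNReal.mul_rpow_of_nonneg _ _ hq0.le, ← ENNReal.rpow_mul, ← ENNReal.rpow_mul,
          inv_mul_cancel₀ hq0.ne', ENNReal.rpow_one, sub_mul, inv_mul_cancel₀ hq0.ne', one_mul]

lemma rpow_tsum_mul_le {ι : Type*} {q : ℝ} (hq : 1 ≤ q) (u f : ι → ℝ≥0∞) :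
    (∑' i, u i * f i) ^ q ≤ (∑' i, u i) ^ (q - 1) * ∑' i, u i * f i ^ q := by
  have hq0 : 0 < q := by linarith
  rw [← ENNReal.le_rpow_inv_iff hq0, ENNReal.tsum_eq_iSup_sum]
  refine iSup_le fun s => ?_
  rw [ENNReal.le_rpow_inv_iff hq0]
  refine (rpow_sum_mul_le s hq u f).trans ?_
  gcongr
  · exact ENNReal.sum_le_tsum s
  · exact ENNReal.sum_le_tsum s

/-- Averages over centered cubes are bounded on `ℓ^q_w`, uniformly in the side of the cube. -/
lemma IsDiscreteAqWeight.exists_layer_bound {q : ℝ} {w : (Fin d → ℤ) → ℝ}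
    (hw : IsDiscreteAqWeight q w) (hq : 1 ≤ q) :
    ∃ D : ℝ≥0∞, D ≠ ∞ ∧ ∀ (m : ℕ) (g : (Fin d → ℤ) → ℝ≥0∞),
      ∑' i, ENNReal.ofReal (w i) * (∑ j ∈ centeredCube m i, g j) ^ q ≤
        D * cubeCard d m ^ q * ∑' j, g j ^ q * ENNReal.ofReal (w j) := by
  rcases hq.eq_or_lt with rfl | hq1
  · obtain ⟨C, hC, h⟩ := hw.2.2 rfl
    refine ⟨ENNReal.ofReal C, ENNReal.ofReal_ne_top, fun m g => ?_⟩
    simp only [ENNReal.rpow_one, Finset.mul_sum]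
    rw [tsum_sum_centeredCube_comm, ← ENNReal.tsum_mul_left]
    refine ENNReal.tsum_le_tsum fun j => ?_
    have hV : (0 : ℝ) < ((2 * m + 1 : ℕ) : ℝ) ^ d := by positivity
    -- After exchanging the sums the cube is centered at `j`, so the `A_1` bound may be evaluated at
    -- `j` itself.
    have hj : j ∈ cube (fun k => j k - m) (2 * m + 1) := by
      change j ∈ centeredCube m j
      rw [mem_centeredCube, sub_self, supAbs_le_iff]
      simp
    have h1 := h (fun k => j k - m) (2 * m + 1) (by omega) j hj
    rw [cubeAvg, inv_mul_le_iff₀ hV] at h1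
    have h2 : ∑ i ∈ centeredCube m j, ENNReal.ofReal (w i) ≤
        cubeCard d m * (ENNReal.ofReal C * ENNReal.ofReal (w j)) := by
      rw [← ENNReal.ofReal_sum_of_nonneg fun i _ => (hw.1 i).le, ← ENNReal.ofReal_mul hC.le,
        cubeCard, ← ENNReal.ofReal_natCast, ← ENNReal.ofReal_mul (Nat.cast_nonneg _),
        Nat.cast_pow]
      exact ENNReal.ofReal_le_ofReal h1
    rw [← Finset.sum_mul]
    calc _ ≤ (cubeCard d m * (ENNReal.ofReal C * ENNReal.ofReal (w j))) * g j := by gcongr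
      _ = _ := by ring
  · obtain ⟨C, hC, h⟩ := hw.exists_sum_mul_le hq1
    have hq0 : 0 < q := by linarith
    refine ⟨C * (2 ^ d) ^ q, ENNReal.mul_ne_top hC
      (ENNReal.rpow_ne_top_of_nonneg hq0.le (by simp)), fun m g => ?_⟩
    set W : (Fin d → ℤ) → ℝ≥0∞ := fun i => ENNReal.ofReal (w i) with hW
    set σ : (Fin d → ℤ) → ℝ≥0∞ := fun i => ENNReal.ofReal (w i ^ (-(1 / (q - 1)))) with hσ
    have hσp : ∀ i, 0 < w i ^ (-(1 / (q - 1))) := fun i => Real.rpow_pos_of_pos (hw.1 i) _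
    have hσ0 : ∀ i, σ i ≠ 0 := fun i => by simpa [hσ] using hσp i
    have hσt : ∀ i, σ i ≠ ∞ := fun i => ENNReal.ofReal_ne_top
    -- The dual weight `σ` is the one for which Hölder with density `σ`, applied to `g / σ`, returns
    -- the weight `w`.
    have hσW : ∀ i, σ i * (σ i)⁻¹ ^ q = W i := by
      intro i
      rw [ENNReal.inv_rpow, ← ENNReal.rpow_neg]
      nth_rw 1 [← ENNReal.rpow_one (σ i)]
      rw [← ENNReal.rpow_add _ _ (hσ0 i) (hσt i)]
      simp only [hσ, hW]
      rw [ENNReal.ofReal_rpow_of_pos (hσp i), ← Real.rpow_mul (hw.1 i).le]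
      have : -(1 / (q - 1)) * (1 + -q) = 1 := by
        have : q - 1 ≠ 0 := by linarith
        field_simp
        ring
      rw [this, Real.rpow_one]
    have hHolder : ∀ i, (∑ j ∈ centeredCube m i, g j) ^ q ≤
        (∑ j ∈ centeredCube m i, σ j) ^ (q - 1) * ∑ j ∈ centeredCube m i, g j ^ q * W j := by
      intro i
      have := rpow_sum_mul_le (centeredCube m i) hq σ (fun j => g j * (σ j)⁻¹)
      have e1 : ∀ j, σ j * (g j * (σ j)⁻¹) = g j := fun j => by
        rw [mul_comm, mul_assoc, ENNReal.inv_mul_cancel (hσ0 j) (hσt j), mul_one]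
      have e2 : ∀ j, σ j * (g j * (σ j)⁻¹) ^ q = g j ^ q * W j := fun j => by
        rw [ENNReal.mul_rpow_of_nonneg _ _ hq0.le, ← hσW j]
        ring
      simpa only [e1, e2] using this
    calc ∑' i, W i * (∑ j ∈ centeredCube m i, g j) ^ q
        ≤ ∑' i, ∑ j ∈ centeredCube m i,
            W i * (∑ j ∈ centeredCube m i, σ j) ^ (q - 1) * (g j ^ q * W j) := by
          refine ENNReal.tsum_le_tsum fun i => ?_
          rw [← Finset.mul_sum, mul_assoc]
          gcongr
          exact hHolder i
      _ = ∑' j, ∑ i ∈ centeredCube m j,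
            W i * (∑ j ∈ centeredCube m i, σ j) ^ (q - 1) * (g j ^ q * W j) :=
          tsum_sum_centeredCube_comm m _
      _ ≤ ∑' j, C * (2 ^ d) ^ q * cubeCard d m ^ q * (g j ^ q * W j) := by
          refine ENNReal.tsum_le_tsum fun j => ?_
          rw [← Finset.sum_mul]
          gcongr
          -- Every cube of radius `m` centered in the cube around `j` lies in the cube of radius
          -- `2m` around `j`. The `A_q` condition there costs only the factor `2^d` in volume.
          calc ∑ i ∈ centeredCube m j, W i * (∑ j ∈ centeredCube m i, σ j) ^ (q - 1)
              ≤ ∑ i ∈ centeredCube m j,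
                  W i * (∑ j ∈ centeredCube (2 * m) j, σ j) ^ (q - 1) := by
                refine Finset.sum_le_sum fun i hi => ?_
                gcongr
                exact centeredCube_subset hi
            _ ≤ (∑ i ∈ centeredCube (2 * m) j, W i) *
                  (∑ j ∈ centeredCube (2 * m) j, σ j) ^ (q - 1) := by
                rw [← Finset.sum_mul]
                gcongr
                exact centeredCube_mono (by omega) j
            _ ≤ C * cubeCard d (2 * m) ^ q := h (2 * m) j
            _ ≤ C * (2 ^ d * cubeCard d m) ^ q := by
                gcongr
                exact cubeCard_two_mul_le m
            _ = _ := by rw [ENNReal.mul_rpow_of_nonneg _ _ hq0.le, mul_assoc]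
      _ = _ := by rw [ENNReal.tsum_mul_left]

/-! ### Radially decreasing majorants and convolution -/

/-- The least radially decreasing majorant of `β`, as a function of the radius. -/
def majorant (β : (Fin d → ℤ) → ℝ≥0∞) (m : ℕ) : ℝ≥0∞ := ⨆ n, ⨆ _ : m ≤ supAbs n, β n

/-- The sum of the least radially decreasing majorant of `β`. -/
def radialNorm (β : (Fin d → ℤ) → ℝ≥0∞) : ℝ≥0∞ :=
  ∑' k : Fin d → ℤ, majorant β (supAbs k)

lemma beurlingNorm_toeplitz (a : (Fin d → ℤ) → ℂ) :
    beurlingNorm (toeplitz a) = radialNorm fun n => ‖a n‖ₑ := by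
  refine tsum_congr fun k => le_antisymm ?_ ?_
  · refine iSup_le fun i => iSup_le fun j => iSup_le fun h => ?_
    rw [norm_eq_supAbs, norm_eq_supAbs, Nat.cast_le] at h
    exact le_iSup₂_of_le (i - j) h le_rfl
  · refine iSup₂_le fun n h => ?_
    refine le_iSup_of_le n (le_iSup_of_le 0 (le_iSup_of_le ?_ ?_))
    · rwa [norm_eq_supAbs, norm_eq_supAbs, Nat.cast_le, sub_zero]
    · simp [toeplitz]

lemma le_majorant (β : (Fin d → ℤ) → ℝ≥0∞) (n : Fin d → ℤ) : β n ≤ majorant β (supAbs n) :=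
  le_iSup₂_of_le n le_rfl le_rfl

lemma majorant_antitone (β : (Fin d → ℤ) → ℝ≥0∞) : Antitone (majorant β) := fun _ _ h =>
  iSup₂_le fun n hn => le_iSup₂_of_le n (h.trans hn) le_rfl

lemma majorant_mono {β γ : (Fin d → ℤ) → ℝ≥0∞} (h : ∀ n, β n ≤ γ n) (m : ℕ) :
    majorant β m ≤ majorant γ m :=
  iSup₂_mono fun n _ => h n

lemma radialNorm_mono {β γ : (Fin d → ℤ) → ℝ≥0∞} (h : ∀ n, β n ≤ γ n) :
    radialNorm β ≤ radialNorm γ :=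
  ENNReal.tsum_le_tsum fun _ => majorant_mono h _

lemma tsum_le_radialNorm (β : (Fin d → ℤ) → ℝ≥0∞) : ∑' n, β n ≤ radialNorm β :=
  ENNReal.tsum_le_tsum (le_majorant β)

lemma supAbs_const (hd : 1 ≤ d) (m : ℕ) : supAbs (fun _ : Fin d => (m : ℤ)) = m := by
  have : Nonempty (Fin d) := ⟨⟨0, hd⟩⟩
  simp [supAbs, Finset.sup_const Finset.univ_nonempty]

/-- The constant vectors `(m,…,m)` have sup norm `m`, so the majorant's values form a subfamily of
the summable family defining `radialNorm β`. -/
lemma tendsto_majorant (hd : 1 ≤ d) {β : (Fin d → ℤ) → ℝ≥0∞} (hβ : radialNorm β ≠ ∞) :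
    Tendsto (majorant β) atTop (𝓝 0) := by
  apply ENNReal.tendsto_atTop_zero_of_tsum_ne_top
  refine ne_top_of_le_ne_top hβ ?_
  have hinj : Function.Injective fun (m : ℕ) (_ : Fin d) => (m : ℤ) := fun m n h => by
    simpa using congrFun h ⟨0, hd⟩
  have := ENNReal.tsum_comp_le_tsum_of_injective hinj fun k => majorant β (supAbs k)
  simp only [supAbs_const hd] at this
  exact this

/-- Telescoping. Truncated subtraction can only enlarge the layers, so no monotonicity is needed
here, only the limit `0`. -/
lemma le_tsum_layers {b : ℕ → ℝ≥0∞} (hb0 : Tendsto b atTop (𝓝 0)) (n : ℕ) :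
    b n ≤ ∑' m, if n ≤ m then b m - b (m + 1) else 0 := by
  set T := ∑' m, if n ≤ m then b m - b (m + 1) else 0
  have key : ∀ M, b n ≤ b (n + M) + ∑ m ∈ Finset.range M, (b (n + m) - b (n + m + 1)) := by
    intro M
    induction M with
    | zero => simp
    | succ M ih =>
      rw [Finset.sum_range_succ]
      refine ih.trans ?_
      have : b (n + M) ≤ b (n + M + 1) + (b (n + M) - b (n + M + 1)) := le_add_tsub
      calc _ ≤ (b (n + M + 1) + (b (n + M) - b (n + M + 1))) + _ := by gcongr
        _ = _ := by rw [← add_assoc n M 1]; ring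
  have key2 : ∀ M, b n ≤ b (n + M) + T := by
    intro M
    refine (key M).trans ?_
    gcongr
    refine (ENNReal.sum_le_tsum _).trans ?_
    have := ENNReal.tsum_comp_le_tsum_of_injective (add_right_injective n)
      fun m => if n ≤ m then b m - b (m + 1) else 0
    simpa using this
  have hlim : Tendsto (fun M => b (n + M) + T) atTop (𝓝 (0 + T)) := by
    refine Tendsto.add_const T (hb0.comp ?_)
    exact tendsto_atTop_mono (fun M => Nat.le_add_left M n) tendsto_id
  simpa using ge_of_tendsto' hlim key2

/-- The converse telescoping bound: monotonicity makes the subtractions exact, and the remainder `b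
(max n M)` is dropped. -/
lemma Antitone.tsum_layers_le {b : ℕ → ℝ≥0∞} (hb : Antitone b) (n : ℕ) :
    (∑' m, if n ≤ m then b m - b (m + 1) else 0) ≤ b n := by
  have key : ∀ M, (∑ m ∈ Finset.range M, if n ≤ m then b m - b (m + 1) else 0) +
      b (max n M) ≤ b n := by
    intro M
    induction M with
    | zero => simp
    | succ M ih =>
      rw [Finset.sum_range_succ]
      split_ifs with h
      · rw [max_eq_right h] at ih
        rw [max_eq_right (by omega), add_assoc, tsub_add_cancel_of_le (hb (Nat.le_succ M))]
        exact ih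
      · rw [max_eq_left (by omega)] at ih ⊢
        simpa using ih
  exact ENNReal.tsum_le_of_sum_range_le fun M => le_self_add.trans (key M)

/-- Convolution with a kernel that has a summable radially decreasing majorant is bounded
on `ℓ^q_w`. -/
lemma IsDiscreteAqWeight.exists_kernel_bound (hd : 1 ≤ d) {q : ℝ} {w : (Fin d → ℤ) → ℝ}
    (hw : IsDiscreteAqWeight q w) (hq : 1 ≤ q) :
    ∃ D : ℝ≥0∞, D ≠ ∞ ∧ ∀ β g : (Fin d → ℤ) → ℝ≥0∞, radialNorm β ≠ ∞ →
      ∑' i, ENNReal.ofReal (w i) * (∑' j, β (i - j) * g j) ^ q ≤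
        D * radialNorm β ^ q * ∑' j, g j ^ q * ENNReal.ofReal (w j) := by
  obtain ⟨D, hD, h⟩ := hw.exists_layer_bound hq
  refine ⟨D, hD, fun β g hβ => ?_⟩
  have hq0 : 0 < q := by linarith
  set b := majorant β
  -- The layer-cake decomposition: the majorant is the sum over `m` of `l m` times the indicator of
  -- the cube of radius `m`.
  set l : ℕ → ℝ≥0∞ := fun m => b m - b (m + 1) with hl
  set V : ℕ → ℝ≥0∞ := cubeCard d
  set G := ∑' j, g j ^ q * ENNReal.ofReal (w j)
  have hV0 : ∀ m, V m ≠ 0 := cubeCard_ne_zero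
  have hVt : ∀ m, V m ≠ ∞ := cubeCard_ne_top
  have hmass : ∑' m, l m * V m ≤ radialNorm β := by
    have e : ∀ m, l m * V m = ∑' n : Fin d → ℤ, if supAbs n ≤ m then l m else 0 := by
      intro m
      have := sum_centeredCube_eq_tsum m (0 : Fin d → ℤ) fun _ => l m
      simp only [zero_sub, supAbs_neg] at this
      rw [← this, Finset.sum_const, card_centeredCube, nsmul_eq_mul, mul_comm]
      rfl
    simp_rw [e]
    rw [ENNReal.tsum_comm]
    exact ENNReal.tsum_le_tsum fun n => (majorant_antitone β).tsum_layers_le _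
  have hpt : ∀ i, ∑' j, β (i - j) * g j ≤
      ∑' m, (l m * V m) * ((V m)⁻¹ * ∑ j ∈ centeredCube m i, g j) := by
    intro i
    calc ∑' j, β (i - j) * g j
        ≤ ∑' j, ∑' m, l m * if supAbs (i - j) ≤ m then g j else 0 := by
          refine ENNReal.tsum_le_tsum fun j => ?_
          calc β (i - j) * g j ≤ b (supAbs (i - j)) * g j := by
                gcongr
                exact le_majorant β _
            _ ≤ (∑' m, if supAbs (i - j) ≤ m then b m - b (m + 1) else 0) * g j := by
                gcongr
                exact le_tsum_layers (tendsto_majorant hd hβ) _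
            _ = _ := by
                rw [← ENNReal.tsum_mul_right]
                refine tsum_congr fun m => ?_
                split_ifs <;> simp [hl]
      _ = ∑' m, l m * ∑ j ∈ centeredCube m i, g j := by
          rw [ENNReal.tsum_comm]
          simp_rw [ENNReal.tsum_mul_left, sum_centeredCube_eq_tsum]
      _ = _ := by
          refine tsum_congr fun m => ?_
          rw [mul_assoc, ← mul_assoc (V m), ENNReal.mul_inv_cancel (hV0 m) (hVt m), one_mul]
  -- The power mean inequality with the masses `l m * V m`, of total at most `radialNorm β`, reduces
  -- the claim to the uniform bound for each cube average.
  calc ∑' i, ENNReal.ofReal (w i) * (∑' j, β (i - j) * g j) ^ q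
      ≤ ∑' i, ENNReal.ofReal (w i) * (radialNorm β ^ (q - 1) *
          ∑' m, (l m * V m) * ((V m)⁻¹ * ∑ j ∈ centeredCube m i, g j) ^ q) := by
        refine ENNReal.tsum_le_tsum fun i => ?_
        gcongr
        refine (ENNReal.rpow_le_rpow (hpt i) hq0.le).trans ((rpow_tsum_mul_le hq _ _).trans ?_)
        gcongr
    _ = radialNorm β ^ (q - 1) * ∑' m, (l m * V m) * ((V m)⁻¹ ^ q *
          ∑' i, ENNReal.ofReal (w i) * (∑ j ∈ centeredCube m i, g j) ^ q) := by
        simp_rw [← ENNReal.tsum_mul_left]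
        rw [ENNReal.tsum_comm]
        refine tsum_congr fun m => tsum_congr fun i => ?_
        rw [ENNReal.mul_rpow_of_nonneg _ _ hq0.le]
        ring
    _ ≤ radialNorm β ^ (q - 1) * ∑' m, (l m * V m) * (D * G) := by
        refine mul_le_mul_right (ENNReal.tsum_le_tsum fun m => mul_le_mul_right ?_ _) _
        calc _ ≤ (V m)⁻¹ ^ q * (D * V m ^ q * G) := mul_le_mul_right (h m g) _
          _ = ((V m)⁻¹ * V m) ^ q * (D * G) := by
              rw [ENNReal.mul_rpow_of_nonneg _ _ hq0.le]
              ring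
          _ = D * G := by
              rw [ENNReal.inv_mul_cancel (hV0 m) (hVt m), ENNReal.one_rpow, one_mul]
    _ ≤ radialNorm β ^ (q - 1) * (radialNorm β * (D * G)) := by
        rw [ENNReal.tsum_mul_right]
        gcongr
    _ = D * radialNorm β ^ q * G := by
        have : radialNorm β ^ q = radialNorm β ^ (q - 1) * radialNorm β := by
          nth_rw 3 [← ENNReal.rpow_one (radialNorm β)]
          rw [← ENNReal.rpow_add_of_nonneg _ _ (by linarith) zero_le_one, sub_add_cancel]
        rw [this]
        ring

/-- Cutting off large cubes makes the radial norm small. -/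
lemma tendsto_radialNorm_tail (hd : 1 ≤ d) {β : (Fin d → ℤ) → ℝ≥0∞} (hβ : radialNorm β ≠ ∞) :
    Tendsto (fun K : ℕ => radialNorm fun n => if supAbs n ≤ K then 0 else β n) atTop (𝓝 0) := by
  let _ : MeasurableSpace (Fin d → ℤ) := ⊤
  have : MeasurableSingletonClass (Fin d → ℤ) := ⟨fun _ => trivial⟩
  unfold radialNorm at hβ ⊢
  simp_rw [← MeasureTheory.lintegral_count] at hβ ⊢
  suffices h : Tendsto (fun K : ℕ => ∫⁻ k : Fin d → ℤ,
      majorant (fun n => if supAbs n ≤ K then 0 else β n) (supAbs k)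
      ∂MeasureTheory.Measure.count) atTop
      (𝓝 (∫⁻ _ : Fin d → ℤ, 0 ∂MeasureTheory.Measure.count)) by
    simpa using h
  refine MeasureTheory.tendsto_lintegral_of_dominated_convergence
    (fun k => majorant β (supAbs k)) (fun _ => measurable_from_top) (fun K => ?_) hβ ?_
  · refine Eventually.of_forall fun k => majorant_mono (fun n => ?_) _
    split_ifs <;> simp
  · refine Eventually.of_forall fun k => ?_
    -- For fixed `k`, the majorant of the part outside radius `K` is at most `majorant β K`.
    refine tendsto_of_tendsto_of_tendsto_of_le_of_le tendsto_const_nhds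
      (tendsto_majorant (β := β) hd ?_) (fun _ => zero_le) fun K => ?_
    · rwa [MeasureTheory.lintegral_count] at hβ
    · refine iSup₂_le fun n _ => ?_
      beta_reduce
      split_ifs with h
      · exact zero_le
      · exact le_iSup₂_of_le n (by omega) le_rfl

/-- The majorant of a point mass at `m` is supported in the cube of radius `supAbs m`. This is the
source of the polynomial growth of the shifts. -/
lemma radialNorm_single_le (m : Fin d → ℤ) :
    radialNorm (fun n => if n = m then 1 else 0) ≤ cubeCard d (supAbs m) := by
  calc radialNorm (fun n => if n = m then 1 else 0)
      ≤ ∑' k : Fin d → ℤ, if supAbs k ≤ supAbs m then (1 : ℝ≥0∞) else 0 := by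
        refine ENNReal.tsum_le_tsum fun k => iSup₂_le fun n hn => ?_
        by_cases h : n = m
        · subst h
          simp [hn]
        · simp [h]
    _ = cubeCard d (supAbs m) := by
        have := sum_centeredCube_eq_tsum (supAbs m) (0 : Fin d → ℤ) fun _ => (1 : ℝ≥0∞)
        simp only [zero_sub, supAbs_neg] at this
        rw [← this, Finset.sum_const, card_centeredCube, nsmul_eq_mul, mul_one]
        rfl

/-! ### Weighted norms, the Toeplitz bound and the passage to `ℓ^q` -/

lemma weightedNorm_eq {q : ℝ} (hq : 0 ≤ q) (w : (Fin d → ℤ) → ℝ) (c : (Fin d → ℤ) → ℂ) :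
    weightedNorm q w c = (∑' i, ‖c i‖ₑ ^ q * ENNReal.ofReal (w i)) ^ (1 / q) := by
  unfold weightedNorm
  congr 1
  refine tsum_congr fun i => ?_
  rw [ENNReal.ofReal_mul (by positivity), ← ENNReal.ofReal_rpow_of_nonneg (norm_nonneg _) hq,
    ofReal_norm]

lemma toeplitz_apply (a : (Fin d → ℤ) → ℂ) (i j : Fin d → ℤ) : toeplitz a i j = a (i - j) := rfl

lemma memEllqw_iff {q : ℝ} (hq : 0 < q) (w : (Fin d → ℤ) → ℝ) (c : (Fin d → ℤ) → ℂ) :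
    MemEllqw q w c ↔ ∑' i, ‖c i‖ₑ ^ q * ENNReal.ofReal (w i) ≠ ∞ := by
  rw [MemEllqw, weightedNorm_eq hq.le, ENNReal.rpow_lt_top_iff_of_pos (by positivity),
    lt_top_iff_ne_top]

/-- Toeplitz matrices in the Beurling class act boundedly on `ℓ^q_w`. -/
lemma IsDiscreteAqWeight.exists_toeplitz_bound (hd : 1 ≤ d) {q : ℝ} {w : (Fin d → ℤ) → ℝ}
    (hw : IsDiscreteAqWeight q w) (hq : 1 ≤ q) :
    ∃ D : ℝ≥0∞, D ≠ ∞ ∧ ∀ a c : (Fin d → ℤ) → ℂ, radialNorm (fun n => ‖a n‖ₑ) ≠ ∞ →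
      MemEllqw q w c → (∀ i, Summable fun j => a (i - j) * c j) ∧
        weightedNorm q w (matrixApply (toeplitz a) c) ≤
          D * radialNorm (fun n => ‖a n‖ₑ) * weightedNorm q w c := by
  obtain ⟨D, hD, h⟩ := hw.exists_kernel_bound hd hq
  have hq0 : 0 < q := by linarith
  refine ⟨D ^ (1 / q), ENNReal.rpow_ne_top_of_nonneg (by positivity) hD, fun a c ha hc => ?_⟩
  have h1 := h (fun n => ‖a n‖ₑ) (fun j => ‖c j‖ₑ) ha
  rw [memEllqw_iff hq0] at hc
  -- Since `w i > 0`, one divergent row would already make the left side of `h1` infinite.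
  have h2 : ∀ i, ∑' j, ‖a (i - j)‖ₑ * ‖c j‖ₑ ≠ ∞ := by
    intro i hi
    have h3 := ((ENNReal.le_tsum i).trans h1).trans_lt
      (ENNReal.mul_lt_top (ENNReal.mul_lt_top hD.lt_top
        (ENNReal.rpow_lt_top_of_nonneg hq0.le ha)) hc.lt_top)
    rw [hi, ENNReal.top_rpow_of_pos hq0, ENNReal.mul_top] at h3
    · exact lt_irrefl _ h3
    · simpa using hw.1 i
  constructor
  · intro i
    apply Summable.of_enorm
    simpa only [enorm_mul] using h2 i
  · rw [weightedNorm_eq hq0.le, weightedNorm_eq hq0.le]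
    calc _ ≤ (D * radialNorm (fun n => ‖a n‖ₑ) ^ q *
          ∑' j, ‖c j‖ₑ ^ q * ENNReal.ofReal (w j)) ^ (1 / q) := by
          refine ENNReal.rpow_le_rpow (le_trans (ENNReal.tsum_le_tsum fun i => ?_) h1)
            (by positivity)
          rw [mul_comm]
          gcongr
          refine (enorm_tsum_le_tsum_enorm).trans_eq ?_
          simp only [enorm_mul, toeplitz_apply]
      _ = _ := by
          rw [ENNReal.mul_rpow_of_nonneg _ _ (by positivity),
            ENNReal.mul_rpow_of_nonneg _ _ (by positivity), ← ENNReal.rpow_mul,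
            mul_one_div_cancel hq0.ne', ENNReal.rpow_one]

/-- The unweighted sequence space `ℓ^q(ℤ^d)`. -/
abbrev Ell (d : ℕ) (q : ℝ) : Type := lp (fun _ : Fin d → ℤ => ℂ) (ENNReal.ofReal q)

/-- The map `f ↦ w^{-1/q} f`, an isometry of `ℓ^q` onto `ℓ^q_w`. -/
def unweight (q : ℝ) (w : (Fin d → ℤ) → ℝ) : Ell d q →ₗ[ℂ] (Fin d → ℤ) → ℂ where
  toFun f i := ((w i ^ (1 / q))⁻¹ : ℝ) * f i
  map_add' f g := by
    ext i
    simp [mul_add]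
  map_smul' r f := by
    ext i
    simp only [lp.coeFn_smul, Pi.smul_apply, smul_eq_mul, RingHom.id_apply]
    ring

lemma unweight_apply (q : ℝ) (w : (Fin d → ℤ) → ℝ) (f : Ell d q) (i : Fin d → ℤ) :
    unweight q w f i = ((w i ^ (1 / q))⁻¹ : ℝ) * f i := rfl

section

variable {q : ℝ} {w : (Fin d → ℤ) → ℝ}

lemma enorm_rpow_mul_weight (hq : 0 < q) (hw : ∀ i, 0 < w i) (i : Fin d → ℤ) (z : ℂ) :
    ‖(((w i ^ (1 / q))⁻¹ : ℝ) : ℂ) * z‖ₑ ^ q * ENNReal.ofReal (w i) = ‖z‖ₑ ^ q := by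
  have h : 0 < w i ^ (1 / q) := Real.rpow_pos_of_pos (hw i) _
  have e : ‖(((w i ^ (1 / q))⁻¹ : ℝ) : ℂ)‖ₑ ^ q = ENNReal.ofReal (w i)⁻¹ := by
    rw [← ofReal_norm, Complex.norm_real, Real.norm_of_nonneg (inv_nonneg.2 h.le),
      ENNReal.ofReal_rpow_of_nonneg (inv_nonneg.2 h.le) hq.le, Real.inv_rpow h.le,
      ← Real.rpow_mul (hw i).le, one_div_mul_cancel hq.ne', Real.rpow_one]
  rw [enorm_mul, ENNReal.mul_rpow_of_nonneg _ _ hq.le, e, mul_right_comm,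
    ← ENNReal.ofReal_mul (inv_nonneg.2 (hw i).le), inv_mul_cancel₀ (hw i).ne',
    ENNReal.ofReal_one, one_mul]

lemma weightedNorm_unweight [Fact (1 ≤ ENNReal.ofReal q)] (hq : 1 ≤ q) (hw : ∀ i, 0 < w i)
    (f : Ell d q) : weightedNorm q w (unweight q w f) = ENNReal.ofReal ‖f‖ := by
  have hq0 : 0 < q := by linarith
  have hp : (ENNReal.ofReal q).toReal = q := ENNReal.toReal_ofReal hq0.le
  rw [weightedNorm_eq hq0.le]
  simp_rw [unweight_apply, enorm_rpow_mul_weight hq0 hw]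
  have hs : Summable fun i => ‖f i‖ ^ q := by
    have := (lp.memℓp f).summable (by rwa [hp])
    rwa [hp] at this
  have e : ∀ i, ‖f i‖ₑ ^ q = ENNReal.ofReal (‖f i‖ ^ q) := fun i => by
    rw [← ofReal_norm, ENNReal.ofReal_rpow_of_nonneg (norm_nonneg _) hq0.le]
  simp_rw [e]
  rw [← ENNReal.ofReal_tsum_of_nonneg (fun i => by positivity) hs,
    ENNReal.ofReal_rpow_of_nonneg (tsum_nonneg fun i => by positivity) (by positivity),
    lp.norm_eq_tsum_rpow (by rwa [hp]), hp]

lemma memEllqw_unweight [Fact (1 ≤ ENNReal.ofReal q)] (hq : 1 ≤ q) (hw : ∀ i, 0 < w i)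
    (f : Ell d q) : MemEllqw q w (unweight q w f) := by
  rw [MemEllqw, weightedNorm_unweight hq hw]
  exact ENNReal.ofReal_lt_top

lemma unweight_injective (hw : ∀ i, 0 < w i) : Function.Injective (unweight (d := d) q w) := by
  intro f g h
  ext i
  have h1 := congrFun h i
  rw [unweight_apply, unweight_apply] at h1
  refine mul_left_cancel₀ ?_ h1
  rw [Ne, Complex.ofReal_eq_zero]
  exact (inv_pos.2 (Real.rpow_pos_of_pos (hw i) _)).ne'

lemma exists_unweight_eq (hq : 1 ≤ q) (hw : ∀ i, 0 < w i) {c : (Fin d → ℤ) → ℂ}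
    (hc : MemEllqw q w c) : ∃ f : Ell d q, unweight q w f = c := by
  have hq0 : 0 < q := by linarith
  have hp : (ENNReal.ofReal q).toReal = q := ENNReal.toReal_ofReal hq0.le
  have h : ∀ i, (0 : ℝ) < w i ^ (1 / q) := fun i => Real.rpow_pos_of_pos (hw i) _
  have e : ∀ i, (((w i ^ (1 / q))⁻¹ : ℝ) : ℂ) * (((w i ^ (1 / q) : ℝ) : ℂ) * c i) = c i := by
    intro i
    rw [← mul_assoc, ← Complex.ofReal_mul, inv_mul_cancel₀ (h i).ne', Complex.ofReal_one, one_mul]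
  refine ⟨⟨fun i => ((w i ^ (1 / q) : ℝ) : ℂ) * c i, ?_⟩, funext e⟩
  apply memℓp_gen
  rw [hp]
  rw [memEllqw_iff hq0] at hc
  have e2 : ∀ i, ‖c i‖ₑ ^ q * ENNReal.ofReal (w i) =
      ENNReal.ofReal (‖((w i ^ (1 / q) : ℝ) : ℂ) * c i‖ ^ q) := by
    intro i
    rw [← ENNReal.ofReal_rpow_of_nonneg (norm_nonneg _) hq0.le, ofReal_norm,
      ← enorm_rpow_mul_weight hq0 hw i (((w i ^ (1 / q) : ℝ) : ℂ) * c i), e]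
  simp_rw [e2] at hc
  refine (ENNReal.summable_toReal hc).congr fun i => ?_
  rw [ENNReal.toReal_ofReal (by positivity)]

end

/-! ### Toeplitz operators and shifts on `ℓ^q` -/

/-- The operator `T` on `ℓ^q` corresponds to the Toeplitz matrix of `a` on `ℓ^q_w`. -/
def Represents (q : ℝ) (w : (Fin d → ℤ) → ℝ) [Fact (1 ≤ ENNReal.ofReal q)]
    (T : Ell d q →L[ℂ] Ell d q) (a : (Fin d → ℤ) → ℂ) : Prop :=
  ∀ f, unweight q w (T f) = matrixApply (toeplitz a) (unweight q w f)

lemma matrixApply_single (n : Fin d → ℤ) (c : (Fin d → ℤ) → ℂ) (i : Fin d → ℤ) :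
    matrixApply (toeplitz (Pi.single n 1)) c i = c (i - n) := by
  rw [matrixApply, tsum_eq_single (i - n)]
  · simp [toeplitz_apply]
  · intro j hj
    rw [toeplitz_apply, Pi.single_eq_of_ne, zero_mul]
    rintro rfl
    simp at hj

lemma radialNorm_single (n : Fin d → ℤ) :
    radialNorm (fun m => ‖(Pi.single n 1 : (Fin d → ℤ) → ℂ) m‖ₑ) ≤ cubeCard d (supAbs n) := by
  refine le_trans (radialNorm_mono fun m => ?_) (radialNorm_single_le n)
  by_cases h : m = n
  · subst h
    simp
  · simp [h]

/-- The part of a convergent convolution beyond a centered cube. -/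
lemma matrixApply_tail {a c : (Fin d → ℤ) → ℂ} {i : Fin d → ℤ}
    (h : Summable fun j => a (i - j) * c j) (K : ℕ) :
    matrixApply (toeplitz a) c i - ∑ n ∈ centeredCube K 0, a n * c (i - n) =
      matrixApply (toeplitz fun n => if supAbs n ≤ K then 0 else a n) c i := by
  have e : ∑ n ∈ centeredCube K 0, a n * c (i - n) =
      ∑' j, if supAbs (i - j) ≤ K then a (i - j) * c j else 0 := by
    rw [← (Equiv.subLeft i).tsum_eq, tsum_eq_sum (s := centeredCube K 0)]
    · refine Finset.sum_congr rfl fun n hn => ?_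
      rw [mem_centeredCube_zero] at hn
      simp [hn]
    · intro n hn
      rw [mem_centeredCube_zero] at hn
      simp [hn]
  have hs : Summable fun j => if supAbs (i - j) ≤ K then a (i - j) * c j else 0 := by
    refine summable_of_ne_finset_zero (s := centeredCube K i) fun j hj => ?_
    rw [mem_centeredCube, supAbs_sub_comm] at hj
    simp [hj]
  rw [e]
  simp only [matrixApply, toeplitz_apply]
  rw [← h.tsum_sub hs]
  refine tsum_congr fun j => ?_
  split_ifs <;> simp

/-- The norm bound covers every operator representing `a`, so that it also applies to differences
between an operator and its truncations. -/
lemma IsDiscreteAqWeight.exists_operator (hd : 1 ≤ d) {q : ℝ} {w : (Fin d → ℤ) → ℝ}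
    (hw : IsDiscreteAqWeight q w) (hq : 1 ≤ q) [Fact (1 ≤ ENNReal.ofReal q)] :
    ∃ D : ℝ, 0 ≤ D ∧ ∀ a : (Fin d → ℤ) → ℂ, radialNorm (fun n => ‖a n‖ₑ) ≠ ∞ →
      (∀ c, MemEllqw q w c → ∀ i, Summable fun j => a (i - j) * c j) ∧
      (∃ T, Represents q w T a) ∧
      ∀ T, Represents q w T a → ‖T‖ ≤ D * (radialNorm fun n => ‖a n‖ₑ).toReal := by
  obtain ⟨D, hD, h⟩ := hw.exists_toeplitz_bound hd hq
  refine ⟨D.toReal, ENNReal.toReal_nonneg, fun a ha => ⟨fun c hc => (h a c ha hc).1, ?_, ?_⟩⟩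
  · have hb : ∀ f g : Ell d q, unweight q w g = matrixApply (toeplitz a) (unweight q w f) →
        ‖g‖ ≤ D.toReal * (radialNorm fun n => ‖a n‖ₑ).toReal * ‖f‖ := by
      intro f g hfg
      have h1 := (h a _ ha (memEllqw_unweight hq hw.1 f)).2
      rw [← hfg, weightedNorm_unweight hq hw.1, weightedNorm_unweight hq hw.1] at h1
      have h2 := ENNReal.toReal_mono (by finiteness) h1
      simpa using h2
    have hex : ∀ f : Ell d q, ∃ g : Ell d q,
        unweight q w g = matrixApply (toeplitz a) (unweight q w f) := by
      intro f
      refine exists_unweight_eq hq hw.1 ?_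
      refine (h a _ ha (memEllqw_unweight hq hw.1 f)).2.trans_lt ?_
      rw [weightedNorm_unweight hq hw.1]
      finiteness
    choose T hT using hex
    have hs := fun f => (h a _ ha (memEllqw_unweight hq hw.1 f)).1
    refine ⟨LinearMap.mkContinuous ⟨⟨T, fun f g => ?_⟩, fun r f => ?_⟩ _
      fun f => hb f _ (hT f), hT⟩
    · apply unweight_injective hw.1
      rw [map_add, hT, hT, hT]
      ext i
      simp only [matrixApply, toeplitz_apply, map_add, Pi.add_apply, mul_add]
      exact (hs f i).tsum_add (hs g i)
    · apply unweight_injective hw.1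
      simp only [map_smul, hT, RingHom.id_apply]
      ext i
      simp only [matrixApply, toeplitz_apply, Pi.smul_apply, smul_eq_mul, ← tsum_mul_left]
      exact tsum_congr fun j => by ring
  · intro T hT
    refine T.opNorm_le_bound (by positivity) fun f => ?_
    have h1 := (h a _ ha (memEllqw_unweight hq hw.1 f)).2
    rw [← hT, weightedNorm_unweight hq hw.1, weightedNorm_unweight hq hw.1] at h1
    have h2 := ENNReal.toReal_mono (by finiteness) h1
    simpa using h2

/-- The shifts form a representation of `ℤ^d` of polynomial growth, and each Toeplitz operator of
the Beurling class is the limit of its truncations to cubes. -/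
lemma IsDiscreteAqWeight.exists_shifts (hd : 1 ≤ d) {q : ℝ} {w : (Fin d → ℤ) → ℝ}
    (hw : IsDiscreteAqWeight q w) (hq : 1 ≤ q) [Fact (1 ≤ ENNReal.ofReal q)] :
    ∃ (D : ℝ) (U : Multiplicative (Fin d → ℤ) →* (Ell d q →L[ℂ] Ell d q)), 0 ≤ D ∧
      (∀ n f i, unweight q w (U (Multiplicative.ofAdd n) f) i = unweight q w f (i - n)) ∧
      (∀ n, ‖U (Multiplicative.ofAdd n)‖ ≤ D * ((2 * supAbs n + 1 : ℕ) : ℝ) ^ d) ∧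
      ∀ a : (Fin d → ℤ) → ℂ, radialNorm (fun n => ‖a n‖ₑ) ≠ ∞ →
        (∀ c, MemEllqw q w c → ∀ i, Summable fun j => a (i - j) * c j) ∧
        ∃ T, Represents q w T a ∧ Tendsto (fun K : ℕ => ∑ n ∈ centeredCube K 0,
          a n • U (Multiplicative.ofAdd n)) atTop (𝓝 T) := by
  obtain ⟨D, hD, h⟩ := hw.exists_operator hd hq
  have hne : ∀ n : Fin d → ℤ,
      radialNorm (fun m => ‖(Pi.single n 1 : (Fin d → ℤ) → ℂ) m‖ₑ) ≠ ∞ := fun n =>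
    ne_top_of_le_ne_top (cubeCard_ne_top _) (radialNorm_single n)
  -- The shift by `n` is the Toeplitz operator of the point mass at `n`.
  choose S hS using fun n => (h _ (hne n)).2.1
  have hSi : ∀ n f i, unweight q w (S n f) i = unweight q w f (i - n) := fun n f i => by
    rw [hS, matrixApply_single]
  refine ⟨D, ⟨⟨fun n => S n.toAdd, ?_⟩, fun m n => ?_⟩, hD, hSi, fun n => ?_, fun a ha => ?_⟩
  · ext1 f
    apply unweight_injective hw.1
    ext i
    rw [hSi]
    simp
  · ext1 f
    apply unweight_injective hw.1
    ext i
    rw [mul_apply_eq_comp, hSi, hSi, hSi, toAdd_mul, sub_sub]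
  · refine ((h _ (hne n)).2.2 _ (hS n)).trans ?_
    gcongr
    refine (ENNReal.toReal_mono (cubeCard_ne_top _) (radialNorm_single n)).trans_eq ?_
    rw [cubeCard, ENNReal.toReal_natCast, Nat.cast_pow]
  · obtain ⟨hs, ⟨T, hT⟩, -⟩ := h a ha
    refine ⟨hs, T, hT, ?_⟩
    have he : ∀ (K : ℕ) n, ‖(if supAbs n ≤ K then 0 else a n)‖ₑ =
        if supAbs n ≤ K then 0 else ‖a n‖ₑ := fun K n => by
      split_ifs <;> simp
    have hta : ∀ K : ℕ, radialNorm (fun n => ‖(if supAbs n ≤ K then 0 else a n)‖ₑ) ≠ ∞ := by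
      intro K
      refine ne_top_of_le_ne_top ha (radialNorm_mono fun n => ?_)
      rw [he]
      split_ifs <;> simp
    -- The truncation error is the Toeplitz operator of the tail of `a`, whose radial norm tends to
    -- `0`.
    have hrep : ∀ K : ℕ, Represents q w (T - ∑ n ∈ centeredCube K 0, a n • S n)
        fun n => if supAbs n ≤ K then 0 else a n := by
      intro K f
      ext i
      rw [← matrixApply_tail (hs _ (memEllqw_unweight hq hw.1 f) i), ← hT]
      simp only [_root_.sub_apply, map_sub, Pi.sub_apply,
        _root_.sum_apply, map_sum, Finset.sum_apply, _root_.smul_apply,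
        map_smul, Pi.smul_apply, hSi, smul_eq_mul]
    have hb : ∀ K, ‖T - ∑ n ∈ centeredCube K 0, a n • S n‖ ≤ D *
        (radialNorm fun n => if supAbs n ≤ K then 0 else ‖a n‖ₑ).toReal := by
      intro K
      have := (h _ (hta K)).2.2 _ (hrep K)
      simpa only [he] using this
    have hlim := ((ENNReal.tendsto_toReal ENNReal.zero_ne_top).comp
      (tendsto_radialNorm_tail hd ha)).const_mul D
    rw [ENNReal.toReal_zero, mul_zero] at hlim
    rw [tendsto_iff_norm_sub_tendsto_zero]
    refine squeeze_zero (fun _ => norm_nonneg _) (fun K => ?_) hlim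
    rw [norm_sub_rev]
    exact hb K

/-! ### Characters of polynomial growth and invertibility -/

lemma le_one_of_pow_le {r C : ℝ} {k : ℕ} (h : ∀ m : ℕ, 1 ≤ m → r ^ m ≤ C * (m : ℝ) ^ k) :
    r ≤ 1 := by
  by_contra! hr
  have h1 := (tendsto_pow_const_div_const_pow_of_one_lt k hr).const_mul C
  rw [mul_zero] at h1
  have h2 : ∀ᶠ m : ℕ in atTop, (1 : ℝ) ≤ C * ((m : ℝ) ^ k / r ^ m) := by
    filter_upwards [eventually_ge_atTop 1] with m hm
    rw [← mul_div_assoc, one_le_div (by positivity)]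
    exact h m hm
  exact absurd (ge_of_tendsto h1 h2) (by norm_num)

lemma supAbs_nsmul_le (m : ℕ) (n : Fin d → ℤ) : supAbs (m • n) ≤ m * supAbs n := by
  rw [supAbs_le_iff]
  intro k
  rw [Pi.smul_apply, nsmul_eq_mul, abs_mul, Nat.abs_cast, Nat.cast_mul]
  gcongr
  exact abs_le_supAbs n k

/-- Multiplicative functionals of polynomial growth on `ℤ^d` are unitary characters. -/
lemma exists_eq_exp_of_growth (ψ : Multiplicative (Fin d → ℤ) →* ℂ) {D : ℝ} {e : ℕ} (hD : 0 ≤ D)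
    (h : ∀ n, ‖ψ (Multiplicative.ofAdd n)‖ ≤ D * ((2 * supAbs n + 1 : ℕ) : ℝ) ^ e) :
    ∃ ξ : Fin d → ℝ, ∀ n, ψ (Multiplicative.ofAdd n) =
      Complex.exp (-Complex.I * ((∑ k, (n k : ℝ) * ξ k : ℝ) : ℂ)) := by
  -- The growth bound at the multiples `m • n` makes the powers of `‖ψ n‖` grow at most polynomially
  -- in `m`; applied to `-n` as well, this forces modulus one.
  have hle : ∀ n, ‖ψ (Multiplicative.ofAdd n)‖ ≤ 1 := by
    intro n
    refine le_one_of_pow_le (C := D * ((2 * supAbs n + 1 : ℕ) : ℝ) ^ e) (k := e) fun m hm => ?_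
    rw [← norm_pow, ← map_pow, ← ofAdd_nsmul]
    refine (h _).trans ?_
    rw [mul_assoc, ← mul_pow, ← Nat.cast_mul]
    gcongr
    have := supAbs_nsmul_le m n
    nlinarith
  have hone : ∀ n, ‖ψ (Multiplicative.ofAdd n)‖ = 1 := by
    intro n
    refine le_antisymm (hle n) ?_
    have h1 : ‖ψ (Multiplicative.ofAdd n)‖ * ‖ψ (Multiplicative.ofAdd (-n))‖ = 1 := by
      rw [← norm_mul, ← map_mul, ← ofAdd_add, add_neg_cancel, ofAdd_zero, map_one, norm_one]
    nlinarith [hle (-n), norm_nonneg (ψ (Multiplicative.ofAdd n))]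
  let z : Fin d → ℂ := fun k => ψ (Multiplicative.ofAdd (Pi.single k 1))
  -- The minus sign matches the convention `exp(-√-1 n·ξ)` of the symbol.
  refine ⟨fun k => -(z k).arg, fun n => ?_⟩
  have hz : ∀ k, Complex.exp ((z k).arg * Complex.I) = z k := fun k => by
    have := Complex.norm_mul_exp_arg_mul_I (z k)
    rwa [hone, Complex.ofReal_one, one_mul] at this
  have hsingle : ∀ k, ψ (Multiplicative.ofAdd (Pi.single k (n k))) = z k ^ n k := by
    intro k
    have e1 : (Pi.single k (n k) : Fin d → ℤ) = n k • Pi.single k 1 := by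
      rw [← Pi.single_smul, smul_eq_mul, mul_one]
    have e2 := congrArg Units.val
      (map_zpow ψ.toHomUnits (Multiplicative.ofAdd (Pi.single k 1 : Fin d → ℤ)) (n k))
    rw [e1, ofAdd_zsmul]
    rw [Units.val_zpow_eq_zpow_val] at e2
    exact e2
  have hn : Multiplicative.ofAdd n =
      ∏ k, Multiplicative.ofAdd (Pi.single k (n k) : Fin d → ℤ) := by
    rw [← ofAdd_sum, Finset.univ_sum_single]
  rw [hn, map_prod, Complex.ofReal_sum, Finset.mul_sum, Complex.exp_sum]
  refine Finset.prod_congr rfl fun k _ => ?_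
  rw [hsingle, ← hz k, ← Complex.exp_int_mul]
  congr 1
  push_cast
  ring

lemma tendsto_centeredCube_atTop :
    Tendsto (fun K : ℕ => centeredCube K (0 : Fin d → ℤ)) atTop atTop :=
  tendsto_atTop_finset_of_monotone (fun _ _ h => centeredCube_mono h 0) fun n =>
    ⟨supAbs n, mem_centeredCube_zero.2 le_rfl⟩

lemma norm_exp_character (n : Fin d → ℤ) (ξ : Fin d → ℝ) :
    ‖Complex.exp (-Complex.I * ((∑ k, (n k : ℝ) * ξ k : ℝ) : ℂ))‖ = 1 := by
  rw [neg_mul, mul_comm, ← neg_mul, ← Complex.ofReal_neg, Complex.norm_exp_ofReal_mul_I]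

lemma tendsto_symbol {a : (Fin d → ℤ) → ℂ} (ha : Summable fun n => ‖a n‖) (ξ : Fin d → ℝ) :
    Tendsto (fun K : ℕ => ∑ n ∈ centeredCube K 0,
      a n * Complex.exp (-Complex.I * ((∑ k, (n k : ℝ) * ξ k : ℝ) : ℂ))) atTop
      (𝓝 (symbol a ξ)) := by
  have hs : Summable fun n : Fin d → ℤ =>
      a n * Complex.exp (-Complex.I * ((∑ k, (n k : ℝ) * ξ k : ℝ) : ℂ)) := by
    refine Summable.of_norm (ha.congr fun n => ?_)
    rw [norm_mul, norm_exp_character, mul_one]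
  exact hs.hasSum.comp tendsto_centeredCube_atTop

/-- Commutativity gives `X ⊆ X'`, hence `X'' ⊆ X'`, and `X''` commutes with `X'`. -/
lemma Subalgebra.mul_comm_of_centralizer_centralizer {B : Type*} [Ring B] [Algebra ℂ B]
    {X : Set B} (hX : ∀ x ∈ X, ∀ y ∈ X, x * y = y * x)
    (x y : Subalgebra.centralizer ℂ (Set.centralizer X)) : x * y = y * x := by
  have h1 : (x : B) ∈ Set.centralizer X :=
    Set.centralizer_subset (fun z hz y hy => hX y hy z hz) x.2
  exact Subtype.ext (y.2 x h1)

/-- A limit of linear combinations of the operators of a representation of `ℤ^d` of polynomial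
growth in a complex Banach algebra is invertible if the symbol has no zeros. -/
lemma isUnit_of_symbol_ne_zero {B : Type*} [NormedRing B] [NormedAlgebra ℂ B] [CompleteSpace B]
    (U : Multiplicative (Fin d → ℤ) →* B) {D : ℝ} {e : ℕ} (hD : 0 ≤ D)
    (hU : ∀ n, ‖U (Multiplicative.ofAdd n)‖ ≤ D * ((2 * supAbs n + 1 : ℕ) : ℝ) ^ e)
    {a : (Fin d → ℤ) → ℂ} (ha : Summable fun n => ‖a n‖) {x : B}
    (hx : Tendsto (fun K : ℕ => ∑ n ∈ centeredCube K 0, a n • U (Multiplicative.ofAdd n)) atTop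
      (𝓝 x)) (hsym : ∀ ξ, symbol a ξ ≠ 0) : IsUnit x := by
  have hcomm : ∀ y ∈ Set.range U, ∀ z ∈ Set.range U, y * z = z * y := by
    rintro _ ⟨m, rfl⟩ _ ⟨n, rfl⟩
    rw [← map_mul, ← map_mul, mul_comm]
  -- The double commutant is closed, commutative and contains the shifts, hence also their limit
  -- `x`.
  let S : Subalgebra ℂ B := Subalgebra.centralizer ℂ (Set.centralizer (Set.range U))
  have hSclosed : IsClosed (S : Set B) := Set.isClosed_centralizer _
  have hUS : ∀ n, U n ∈ S := fun n => Set.subset_centralizer_centralizer ⟨n, rfl⟩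
  have hxS : x ∈ S := hSclosed.mem_of_tendsto hx
    (Eventually.of_forall fun K => S.sum_mem fun n _ => S.smul_mem (hUS _) _)
  let _ : NormedCommRing S :=
    { (inferInstance : NormedRing S) with
      mul_comm := Subalgebra.mul_comm_of_centralizer_centralizer hcomm }
  have : CompleteSpace S := hSclosed.completeSpace_coe
  suffices h : IsUnit (⟨x, hxS⟩ : S) from h.map S.val
  by_contra hnot
  obtain ⟨φ, hφ⟩ := WeakDual.CharacterSpace.exists_apply_eq_zero hnot
  let V : Multiplicative (Fin d → ℤ) →* S :=
    { toFun := fun n => ⟨U n, hUS n⟩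
      map_one' := Subtype.ext (map_one U)
      map_mul' := fun m n => Subtype.ext (map_mul U m n) }
  -- The factor `‖1‖` appears because the unit is not assumed to have norm one.
  obtain ⟨ξ, hξ⟩ := exists_eq_exp_of_growth
    ((MonoidHomClass.toMonoidHom φ).comp V) (D := D * ‖(1 : S)‖) (e := e)
    (by positivity) fun n => by
      refine (AlgHom.norm_apply_le_self_mul_norm_one φ (V (Multiplicative.ofAdd n))).trans ?_
      calc _ ≤ D * ((2 * supAbs n + 1 : ℕ) : ℝ) ^ e * ‖(1 : S)‖ := by
            gcongr
            exact hU n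
        _ = _ := by ring
  have hlim : Tendsto (fun K : ℕ => ∑ n ∈ centeredCube K 0, a n • V (Multiplicative.ofAdd n))
      atTop (𝓝 (⟨x, hxS⟩ : S)) := by
    rw [tendsto_subtype_rng]
    convert hx using 2 with K
    simp [V]
  have h1 := ((map_continuous φ).tendsto _).comp hlim
  rw [hφ] at h1
  refine hsym ξ (tendsto_nhds_unique (tendsto_symbol ha ξ) ?_)
  refine h1.congr fun K => ?_
  simp only [Function.comp_apply, map_sum, map_smul, smul_eq_mul]
  exact Finset.sum_congr rfl fun n _ => congrArg _ (hξ n)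

/-! ### Growth of the weight and approximate eigenvectors -/

lemma exists_le_mul_of_growth {s : ℕ → ℝ} {C : ℝ} {k : ℕ} (hC : 0 ≤ C) (hs0 : 0 < s 0)
    (hs : ∀ N, s N ≤ C * ((2 * N + 1 : ℕ) : ℝ) ^ k) (L : ℕ) {ε : ℝ} (hε : 0 < ε) :
    ∃ N, s (N + L) ≤ (1 + ε) * s N := by
  -- Otherwise `s (m * L)` is at least `(1 + ε)^m * s 0`, against polynomial growth.
  by_contra! h
  have hpow : ∀ m : ℕ, (1 + ε) ^ m * s 0 ≤ s (m * L) := by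
    intro m
    induction m with
    | zero => simp
    | succ m ih =>
      have h1 := h (m * L)
      rw [Nat.succ_mul]
      calc (1 + ε) ^ (m + 1) * s 0 = (1 + ε) * ((1 + ε) ^ m * s 0) := by ring
        _ ≤ (1 + ε) * s (m * L) := by gcongr
        _ ≤ _ := h1.le
  have h1 : 1 + ε ≤ 1 := by
    refine le_one_of_pow_le (C := C * ((2 * L + 1 : ℕ) : ℝ) ^ k / s 0) (k := k) fun m hm => ?_
    rw [div_mul_eq_mul_div, le_div_iff₀ hs0, mul_assoc, ← mul_pow, ← Nat.cast_mul]
    refine (hpow m).trans ((hs _).trans ?_)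
    gcongr
    nlinarith
  linarith

section

variable {q : ℝ} {w : (Fin d → ℤ) → ℝ}

lemma norm_rpow_eq_tsum_unweight (hq : 0 < q) (hw : ∀ i, 0 < w i) (f : Ell d q) :
    ‖f‖ ^ q = ∑' i, ‖unweight q w f i‖ ^ q * w i := by
  have hp : (ENNReal.ofReal q).toReal = q := ENNReal.toReal_ofReal hq.le
  have h1 := lp.norm_rpow_eq_tsum (by rwa [hp]) f
  rw [hp] at h1
  rw [h1]
  refine tsum_congr fun i => ?_
  have h : 0 < w i ^ (1 / q) := Real.rpow_pos_of_pos (hw i) _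
  rw [unweight_apply, norm_mul, Complex.norm_real, Real.norm_of_nonneg (inv_nonneg.2 h.le),
    Real.mul_rpow (inv_nonneg.2 h.le) (norm_nonneg _), Real.inv_rpow h.le,
    ← Real.rpow_mul (hw i).le, one_div_mul_cancel hq.ne', Real.rpow_one, mul_right_comm,
    inv_mul_cancel₀ (hw i).ne', one_mul]

lemma norm_rpow_eq_sum_unweight (hq : 0 < q) (hw : ∀ i, 0 < w i) {f : Ell d q}
    {s : Finset (Fin d → ℤ)} (hf : ∀ i ∉ s, unweight q w f i = 0) :
    ‖f‖ ^ q = ∑ i ∈ s, ‖unweight q w f i‖ ^ q * w i := by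
  rw [norm_rpow_eq_tsum_unweight hq hw]
  refine tsum_eq_sum fun i hi => ?_
  rw [hf i hi, norm_zero, Real.zero_rpow hq.ne', zero_mul]

lemma exists_unweight_eq_of_finset (hq : 1 ≤ q) (hw : ∀ i, 0 < w i) {c : (Fin d → ℤ) → ℂ}
    {s : Finset (Fin d → ℤ)} (hc : ∀ i ∉ s, c i = 0) : ∃ f : Ell d q, unweight q w f = c := by
  have hq0 : 0 < q := by linarith
  apply exists_unweight_eq hq hw
  rw [memEllqw_iff hq0, tsum_eq_sum (s := s)]
  · refine ENNReal.sum_ne_top.2 fun i _ => ?_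
    finiteness
  · intro i hi
    rw [hc i hi, enorm_zero, ENNReal.zero_rpow_of_pos hq0, zero_mul]

variable [Fact (1 ≤ ENNReal.ofReal q)] {D : ℝ} {U : Multiplicative (Fin d → ℤ) →* (Ell d q →L[ℂ] Ell d q)}

/-- The shift by `n` carries the point mass at `0` to the one at `n`, and the `q`-th powers of their
norms are `w 0` and `w n`. -/
lemma weight_le_of_shift_bound (hq : 1 ≤ q) (hw : ∀ i, 0 < w i) (hD : 0 ≤ D)
    (hUi : ∀ n f i, unweight q w (U (Multiplicative.ofAdd n) f) i = unweight q w f (i - n))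
    (hU : ∀ n, ‖U (Multiplicative.ofAdd n)‖ ≤ D * ((2 * supAbs n + 1 : ℕ) : ℝ) ^ d)
    (n : Fin d → ℤ) : w n ≤ (D * ((2 * supAbs n + 1 : ℕ) : ℝ) ^ d) ^ q * w 0 := by
  have hq0 : 0 < q := by linarith
  obtain ⟨f, hf⟩ := exists_unweight_eq_of_finset (q := q) hq hw
    (c := Pi.single 0 1) (s := {0}) fun i hi => by
      rw [Finset.mem_singleton] at hi
      exact Pi.single_eq_of_ne hi 1
  have h0 : ‖f‖ ^ q = w 0 := by
    rw [norm_rpow_eq_sum_unweight hq0 hw (s := {0})]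
    · simp [hf]
    · intro i hi
      rw [Finset.mem_singleton] at hi
      rw [hf, Pi.single_eq_of_ne hi]
  have h1 : ‖U (Multiplicative.ofAdd n) f‖ ^ q = w n := by
    rw [norm_rpow_eq_sum_unweight hq0 hw (s := {n})]
    · simp [hUi, hf]
    · intro i hi
      rw [Finset.mem_singleton] at hi
      rw [hUi, hf, Pi.single_eq_of_ne (sub_ne_zero.2 hi)]
  rw [← h0, ← h1, ← Real.mul_rpow (by positivity) (norm_nonneg _)]
  refine Real.rpow_le_rpow (norm_nonneg _) ?_ hq0.le
  exact ((U (Multiplicative.ofAdd n)).le_opNorm f).trans (by gcongr; exact hU n)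

lemma exists_cube_growth (hq : 1 ≤ q) (hw : ∀ i, 0 < w i) (hD : 0 ≤ D)
    (hUi : ∀ n f i, unweight q w (U (Multiplicative.ofAdd n) f) i = unweight q w f (i - n))
    (hU : ∀ n, ‖U (Multiplicative.ofAdd n)‖ ≤ D * ((2 * supAbs n + 1 : ℕ) : ℝ) ^ d) :
    ∃ (C : ℝ) (k : ℕ), 0 ≤ C ∧ ∀ N : ℕ, ∑ i ∈ centeredCube N (0 : Fin d → ℤ), w i ≤
      C * ((2 * N + 1 : ℕ) : ℝ) ^ k := by
  have hq0 : 0 < q := by linarith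
  -- The exponent `d` counts the points; `d * ⌈q⌉₊` bounds each weight, with `q` rounded up to get a
  -- natural power.
  refine ⟨D ^ q * w 0, d + d * ⌈q⌉₊, by have := (hw 0).le; positivity, fun N => ?_⟩
  have hb : ∀ i ∈ centeredCube N (0 : Fin d → ℤ),
      w i ≤ D ^ q * w 0 * ((2 * N + 1 : ℕ) : ℝ) ^ (d * ⌈q⌉₊) := by
    intro i hi
    rw [mem_centeredCube_zero] at hi
    refine (weight_le_of_shift_bound hq hw hD hUi hU i).trans ?_
    rw [Real.mul_rpow hD (by positivity), mul_right_comm]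
    have := (hw 0).le
    gcongr
    calc (((2 * supAbs i + 1 : ℕ) : ℝ) ^ d) ^ q ≤ (((2 * N + 1 : ℕ) : ℝ) ^ d) ^ q := by
          gcongr
      _ ≤ (((2 * N + 1 : ℕ) : ℝ) ^ d) ^ (⌈q⌉₊ : ℝ) := by
          refine Real.rpow_le_rpow_of_exponent_le ?_ (Nat.le_ceil q)
          refine one_le_pow₀ ?_
          exact_mod_cast Nat.le_add_left 1 (2 * N)
      _ = _ := by rw [Real.rpow_natCast, pow_mul]
  refine (Finset.sum_le_card_nsmul _ _ _ hb).trans_eq ?_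
  rw [card_centeredCube, nsmul_eq_mul, pow_add, Nat.cast_pow]
  ring

/-- The truncations of a Toeplitz operator have approximate eigenvectors for the values of
their symbols: characters cut off to large cubes. -/
lemma exists_approx_eigenvector (hq : 1 ≤ q) (hw : ∀ i, 0 < w i) (hD : 0 ≤ D)
    (hUi : ∀ n f i, unweight q w (U (Multiplicative.ofAdd n) f) i = unweight q w f (i - n))
    (hU : ∀ n, ‖U (Multiplicative.ofAdd n)‖ ≤ D * ((2 * supAbs n + 1 : ℕ) : ℝ) ^ d)
    (a : (Fin d → ℤ) → ℂ) (ξ : Fin d → ℝ) (K : ℕ) {δ : ℝ} (hδ : 0 < δ)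
    (hsym : ‖∑ n ∈ centeredCube K 0,
      a n * Complex.exp (-Complex.I * ((∑ k, (n k : ℝ) * ξ k : ℝ) : ℂ))‖ ≤ δ) :
    ∃ f : Ell d q, 0 < ‖f‖ ∧
      ‖(∑ n ∈ centeredCube K 0, a n • U (Multiplicative.ofAdd n)) f‖ ≤ 2 * δ * ‖f‖ := by
  have hq0 : 0 < q := by linarith
  set E : (Fin d → ℤ) → ℂ := fun n =>
    Complex.exp (-Complex.I * ((∑ k, (n k : ℝ) * ξ k : ℝ) : ℂ)) with hE
  have hEadd : ∀ m n, E (m + n) = E m * E n := fun m n => by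
    simp only [hE]
    rw [← Complex.exp_add, ← mul_add, ← Complex.ofReal_add, ← Finset.sum_add_distrib]
    simp only [Pi.add_apply, Int.cast_add, add_mul]
  have hEnorm : ∀ n, ‖E n‖ = 1 := fun n => norm_exp_character n ξ
  set M : ℝ := ∑ n ∈ centeredCube K 0, ‖a n‖
  have hM : 0 ≤ M := Finset.sum_nonneg fun _ _ => norm_nonneg _
  set s : ℕ → ℝ := fun N => ∑ i ∈ centeredCube N (0 : Fin d → ℤ), w i with hs
  have hspos : ∀ N, 0 < s N := fun N => Finset.sum_pos (fun i _ => hw i)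
    ⟨0, mem_centeredCube.2 (by simp [supAbs])⟩
  have hsmono : Monotone s := fun m n h => Finset.sum_le_sum_of_subset_of_nonneg
    (centeredCube_mono h 0) fun i _ _ => (hw i).le
  obtain ⟨C, k, hC, hgrowth⟩ := exists_cube_growth hq hw hD hUi hU
  -- Chosen so that `M ^ q * ε ≤ δ ^ q`; the `+ 1` covers `M = 0`.
  set ε : ℝ := δ ^ q / (M ^ q + 1) with hεdef
  have hMq : 0 ≤ M ^ q := Real.rpow_nonneg hM q
  have hδq : 0 < δ ^ q := Real.rpow_pos_of_pos hδ q
  have hε : 0 < ε := by positivity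
  have hMε : M ^ q * ε ≤ δ ^ q := by
    rw [hεdef, mul_div_assoc', div_le_iff₀ (by positivity)]
    nlinarith
  obtain ⟨N, hN⟩ := exists_le_mul_of_growth hC (hspos 0) hgrowth (2 * K) hε
  -- With cutoff radius `N + K`, the image is the truncated symbol times the character within radius
  -- `N`, and vanishes beyond `N + 2K`. Only the shell between them is uncontrolled; there the crude
  -- bound `M` suffices.
  obtain ⟨f, hf⟩ := exists_unweight_eq_of_finset (q := q) hq hw
    (c := fun j => if supAbs j ≤ N + K then E (-j) else 0) (s := centeredCube (N + K) 0)
    fun i hi => if_neg (by rwa [mem_centeredCube_zero] at hi)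
  have hnf : ‖f‖ ^ q = s (N + K) := by
    rw [norm_rpow_eq_sum_unweight hq0 hw (s := centeredCube (N + K) 0)]
    · refine Finset.sum_congr rfl fun i hi => ?_
      rw [mem_centeredCube_zero] at hi
      simp only [hf, if_pos hi, hEnorm, Real.one_rpow, one_mul]
    · intro i hi
      rw [mem_centeredCube_zero] at hi
      simp only [hf, if_neg hi]
  refine ⟨f, ?_, ?_⟩
  · rw [norm_pos_iff]
    rintro rfl
    rw [norm_zero, Real.zero_rpow hq0.ne'] at hnf
    exact (hspos (N + K)).ne hnf
  set g := (∑ n ∈ centeredCube K 0, a n • U (Multiplicative.ofAdd n)) f with hg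
  have hgi : ∀ i, unweight q w g i =
      ∑ n ∈ centeredCube K 0, a n * if supAbs (i - n) ≤ N + K then E (-(i - n)) else 0 := by
    intro i
    simp only [hg, _root_.sum_apply, map_sum, Finset.sum_apply, _root_.smul_apply,
      map_smul, Pi.smul_apply, hUi, smul_eq_mul, hf]
  have hout : ∀ i ∉ centeredCube (N + 2 * K) 0, unweight q w g i = 0 := by
    intro i hi
    rw [mem_centeredCube_zero] at hi
    rw [hgi]
    refine Finset.sum_eq_zero fun n hn => ?_
    rw [mem_centeredCube_zero] at hn
    have := supAbs_add_le (i - n) n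
    rw [sub_add_cancel] at this
    rw [if_neg (by omega), mul_zero]
  have hin : ∀ i ∈ centeredCube N 0, ‖unweight q w g i‖ ≤ δ := by
    intro i hi
    rw [mem_centeredCube_zero] at hi
    have e : unweight q w g i = E (-i) * ∑ n ∈ centeredCube K 0, a n * E n := by
      rw [hgi, Finset.mul_sum]
      refine Finset.sum_congr rfl fun n hn => ?_
      rw [mem_centeredCube_zero] at hn
      have := supAbs_add_le i (-n)
      rw [supAbs_neg, ← sub_eq_add_neg] at this
      rw [if_pos (by omega), neg_sub, sub_eq_add_neg, hEadd]
      ring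
    rw [e, norm_mul, hEnorm, one_mul]
    exact hsym
  have hall : ∀ i, ‖unweight q w g i‖ ≤ M := by
    intro i
    rw [hgi]
    refine norm_sum_le_of_le _ fun n _ => ?_
    rw [norm_mul]
    refine mul_le_of_le_one_right (norm_nonneg _) ?_
    split_ifs
    · exact (hEnorm _).le
    · simp
  have hng : ‖g‖ ^ q ≤ 2 * δ ^ q * ‖f‖ ^ q := by
    rw [norm_rpow_eq_sum_unweight hq0 hw hout, hnf,
      ← Finset.sum_sdiff (centeredCube_mono (Nat.le_add_right N (2 * K)) 0)]
    have h1 : ∑ i ∈ centeredCube (N + 2 * K) 0 \ centeredCube N 0,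
        ‖unweight q w g i‖ ^ q * w i ≤ M ^ q * (s (N + 2 * K) - s N) := by
      rw [hs]
      simp only
      rw [← Finset.sum_sdiff (centeredCube_mono (Nat.le_add_right N (2 * K)) 0),
        add_sub_cancel_right, Finset.mul_sum]
      refine Finset.sum_le_sum fun i _ => mul_le_mul_of_nonneg_right ?_ (hw i).le
      exact Real.rpow_le_rpow (norm_nonneg _) (hall i) hq0.le
    have h2 : ∑ i ∈ centeredCube N 0, ‖unweight q w g i‖ ^ q * w i ≤ δ ^ q * s N := by
      rw [hs]
      simp only
      rw [Finset.mul_sum]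
      refine Finset.sum_le_sum fun i hi => mul_le_mul_of_nonneg_right ?_ (hw i).le
      exact Real.rpow_le_rpow (norm_nonneg _) (hin i hi) hq0.le
    have h3 : s N ≤ s (N + K) := hsmono (Nat.le_add_right N K)
    calc _ ≤ M ^ q * (ε * s N) + δ ^ q * s N := by
          refine add_le_add (h1.trans ?_) h2
          gcongr
          linarith
      _ = (M ^ q * ε + δ ^ q) * s N := by ring
      _ ≤ (δ ^ q + δ ^ q) * s (N + K) := by
          have := (hspos N).le
          gcongr
      _ = _ := by ring
  -- Here `2 * δ ^ q ≤ (2 * δ) ^ q` because `q ≥ 1`.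
  refine (Real.rpow_le_rpow_iff (norm_nonneg _) (by positivity) hq0).1 (hng.trans ?_)
  rw [Real.mul_rpow (by positivity) (norm_nonneg _), Real.mul_rpow zero_le_two hδ.le]
  gcongr
  calc (2 : ℝ) = 2 ^ (1 : ℝ) := (Real.rpow_one 2).symm
    _ ≤ 2 ^ q := Real.rpow_le_rpow_of_exponent_le one_le_two hq

end

end

/-! ### The equivalence -/

theorem mainTheorem8 (d : ℕ) (hd : 1 ≤ d) (q : ℝ) (hq : 1 ≤ q)
    (w : (Fin d → ℤ) → ℝ) (hw : IsDiscreteAqWeight q w)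
    (a : (Fin d → ℤ) → ℂ) (ha : MemBeurling (toeplitz a)) :
    HasStability q w (toeplitz a) ↔ ∀ ξ : Fin d → ℝ, symbol a ξ ≠ 0 := by
  have : Fact (1 ≤ ENNReal.ofReal q) := ⟨ENNReal.one_le_ofReal.2 hq⟩
  rw [MemBeurling, beurlingNorm_toeplitz, lt_top_iff_ne_top] at ha
  have hsum : Summable fun n => ‖a n‖ := by
    have h1 := ENNReal.summable_toReal (ne_top_of_le_ne_top ha (tsum_le_radialNorm _))
    exact h1.congr fun n => toReal_enorm _
  obtain ⟨D, U, hD, hUi, hU, hT⟩ := hw.exists_shifts hd hq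
  obtain ⟨hs, T, hTa, hlim⟩ := hT a ha
  constructor
  · rintro ⟨C, hC, hstab⟩ ξ hξ
    have hlow : ∀ f, C⁻¹ * ‖f‖ ≤ ‖T f‖ := by
      intro f
      have h1 := (hstab _ (memEllqw_unweight hq hw.1 f)).2.1
      rw [← hTa, weightedNorm_unweight hq hw.1, weightedNorm_unweight hq hw.1,
        ← ENNReal.ofReal_mul (by positivity)] at h1
      exact (ENNReal.ofReal_le_ofReal_iff (norm_nonneg _)).1 h1
    -- The approximate eigenvector costs `2δ` and the truncation `δ`, so `‖T f‖ ≤ 3δ‖f‖ < C⁻¹‖f‖`, a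
    -- contradiction.
    have hδ : 0 < C⁻¹ / 4 := by positivity
    have h1 := tendsto_iff_norm_sub_tendsto_zero.1 hlim
    have h2 := (tendsto_symbol hsum ξ).norm
    rw [hξ, norm_zero] at h2
    obtain ⟨K, hK1, hK2⟩ := ((h1.eventually_lt_const hδ).and (h2.eventually_lt_const hδ)).exists
    obtain ⟨f, hf0, hf⟩ := exists_approx_eigenvector hq hw.1 hD hUi hU a ξ K hδ hK2.le
    set TK := ∑ n ∈ centeredCube K 0, a n • U (Multiplicative.ofAdd n)
    have h3 : ‖T f‖ ≤ ‖TK f‖ + ‖(TK - T) f‖ := by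
      have := norm_sub_le (TK f) ((TK - T) f)
      rwa [_root_.sub_apply, sub_sub_cancel] at this
    have h4 := (TK - T).le_opNorm f
    have h5 := hlow f
    have h6 : ‖TK - T‖ * ‖f‖ ≤ C⁻¹ / 4 * ‖f‖ := by gcongr
    have h7 : 0 < C⁻¹ * ‖f‖ := by positivity
    linarith
  · intro hsym
    -- A bounded left inverse is all that the lower stability bound requires.
    obtain ⟨V, hV⟩ := (isUnit_of_symbol_ne_zero U hD hU hsum hlim hsym).exists_left_inv
    refine ⟨‖T‖ + ‖V‖ + 1, by positivity, fun c hc => ⟨hs c hc, ?_⟩⟩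
    obtain ⟨f, rfl⟩ := exists_unweight_eq hq hw.1 hc
    have hVf : ‖f‖ ≤ ‖V‖ * ‖T f‖ := by
      have h1 : V (T f) = f := by
        rw [← mul_apply_eq_comp, hV, one_apply_eq_self]
      nth_rw 1 [← h1]
      exact V.le_opNorm _
    rw [← hTa, weightedNorm_unweight hq hw.1, weightedNorm_unweight hq hw.1,
      ← ENNReal.ofReal_mul (by positivity), ← ENNReal.ofReal_mul (by positivity)]
    constructor
    · apply ENNReal.ofReal_le_ofReal
      rw [inv_mul_le_iff₀ (by positivity)]
      refine hVf.trans ?_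
      gcongr
      linarith [norm_nonneg T]
    · apply ENNReal.ofReal_le_ofReal
      refine (T.le_opNorm f).trans ?_
      gcongr
      linarith [norm_nonneg V]
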